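/- Let $\Sigma^+\neq\emptyset$ be a one-sided subshift of finite type on a finite alphabet, with shift map $\sigma:\Sigma^+\to\Sigma^+$, and assume that $\sigma$ is topologically mixing. Fix $0<\lambda<1$ and let $d(x,y)=\lambda^{n}$ with $n=\min\{k\ge 0: x_k\neq y_k\}$ for $x\ne y$, and $d(x,x)=0$. For $0<\alpha\le 1$ let $C^\alpha(\Sigma^+,\mathbb R)$ be the space of $\alpha$-Hölder functions $A:\Sigma^+\to\mathbb R$ with the norm $$\|A\|_\alpha=\sup_{0<d(x,y)\le 1}\frac{|A(x)-A(y)|}{d(x,y)^\alpha}+\sup_{x}|A(x)|,$$ and let $C^\alpha_0(\Sigma^+,\mathbb R)\subseteq C^\alpha(\Sigma^+,\mathbb R)$ be the subset of functions with zero topological pressure, with the induced topology. Here the topological pressure is $$P(A)=\lim_{n\to\infty}\frac1n\log\sum_{w}\exp\Big(\sup_{x\in[w]}\sum_{k=0}^{n-1}A(\sigma^k x)\Big),$$ where $w$ runs over the words of length $n$ whose cylinder $[w]\subseteq\Sigma^+$ is nonempty. Then there is a residual subset $\mathcal G_1$ of $C^\alpha_0(\Sigma^+,\mathbb R)$ such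 that every $A\in\mathcal G_1$ has exactly one maximizing measure $\mu$, that is, exactly one $\sigma$-invariant Borel probability $\mu$ with $$\int A\,d\mu=\max\Big\{\int A\,d\nu : \nu \text{ a } \sigma\text{-invariant Borel probability on }\Sigma^+\Big\},$$ and moreover the support of $\mu$ is uniquely ergodic: it is forward invariant under $\sigma$ and carries exactly one $\sigma$-invariant Borel probability. -/

import Mathlib

open MeasureTheory Filter Topology

noncomputable section

/-- A presentation of a one-sided subshift of finite type on the alphabet `{0, …, q - 1}`:
a window length and the set of words of that length which are allowed
(the finitely many other words of that length are the forbidden ones). -/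
structure SFT (q : ℕ) where
  window : ℕ
  allowed : Set (Fin window → Fin q)

namespace SFT

variable {q : ℕ} (F : SFT q)

/-- The set of one-sided sequences all of whose windows are allowed. It carries the topology and
the Borel σ-algebra induced from the product `ℕ → Fin q` of discrete spaces. -/
def space : Set (ℕ → Fin q) :=
  {x | ∀ k : ℕ, (fun i : Fin F.window => x (k + i)) ∈ F.allowed}

/-- The shift map `(x₀, x₁, x₂, …) ↦ (x₁, x₂, …)`. -/
def shift (x : F.space) : F.space :=
  ⟨fun n => x.1 (n + 1), fun k => by
    have h := x.2 (k + 1)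
    simpa only [Nat.add_right_comm] using h⟩

/-- Topological mixing of the shift map. -/
def TopologicallyMixing : Prop :=
  ∀ U V : Set F.space, IsOpen U → IsOpen V → U.Nonempty → V.Nonempty →
    ∃ N : ℕ, ∀ n ≥ N, (U ∩ F.shift^[n] ⁻¹' V).Nonempty

/-- The distance `d(x, y) = l ^ n` where `n` is the least index with `x n ≠ y n`,
and `d(x, x) = 0`. -/
def seqDist (l : ℝ) (x y : F.space) : ℝ :=
  open Classical in if x = y then 0 else l ^ PiNat.firstDiff x.1 y.1

/-- The quotients `|A x - A y| / d(x, y) ^ α` for `0 < d(x, y) ≤ 1`. -/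
def holderQuotients (l α : ℝ) (A : F.space → ℝ) : Set ℝ :=
  {r | ∃ x y : F.space, 0 < F.seqDist l x y ∧ F.seqDist l x y ≤ 1 ∧
    r = |A x - A y| / F.seqDist l x y ^ α}

/-- The Hölder seminorm `Hold_α(A)`. -/
def holderSeminorm (l α : ℝ) (A : F.space → ℝ) : ℝ :=
  sSup (F.holderQuotients l α A)

/-- The supremum norm `‖A‖₀`. -/
def supNorm (A : F.space → ℝ) : ℝ :=
  sSup (Set.range fun x => |A x|)

/-- The functions for which the suprema defining `‖A‖₀` and `Hold_α(A)` are both finite. -/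
def IsHolder (l α : ℝ) (A : F.space → ℝ) : Prop :=
  BddAbove (Set.range fun x => |A x|) ∧ BddAbove (F.holderQuotients l α A)

variable {F} {l α : ℝ} {A B : F.space → ℝ}

theorem supNorm_nonneg : 0 ≤ F.supNorm A := by
  refine Real.sSup_nonneg ?_
  rintro _ ⟨x, rfl⟩
  exact abs_nonneg _

theorem holderSeminorm_nonneg : 0 ≤ F.holderSeminorm l α A := by
  refine Real.sSup_nonneg ?_
  rintro _ ⟨x, y, h, -, rfl⟩
  positivity

theorem IsHolder.abs_le (hA : F.IsHolder l α A) (x : F.space) : |A x| ≤ F.supNorm A :=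
  le_csSup hA.1 ⟨x, rfl⟩

theorem IsHolder.quot_le (hA : F.IsHolder l α A) (x y : F.space) (h : 0 < F.seqDist l x y)
    (h' : F.seqDist l x y ≤ 1) :
    |A x - A y| / F.seqDist l x y ^ α ≤ F.holderSeminorm l α A :=
  le_csSup hA.2 ⟨x, y, h, h', rfl⟩

theorem IsHolder.add_abs_le (hA : F.IsHolder l α A) (hB : F.IsHolder l α B) :
    ∀ r ∈ Set.range (fun x => |(A + B) x|), r ≤ F.supNorm A + F.supNorm B := by
  rintro _ ⟨x, rfl⟩
  exact (abs_add_le _ _).trans (add_le_add (hA.abs_le x) (hB.abs_le x))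

theorem IsHolder.add_quot_le (hA : F.IsHolder l α A) (hB : F.IsHolder l α B) :
    ∀ r ∈ F.holderQuotients l α (A + B),
      r ≤ F.holderSeminorm l α A + F.holderSeminorm l α B := by
  rintro _ ⟨x, y, h, h', rfl⟩
  refine le_trans ?_ (add_le_add (hA.quot_le x y h h') (hB.quot_le x y h h'))
  rw [← add_div]
  have hp : 0 < F.seqDist l x y ^ α := Real.rpow_pos_of_pos h α
  refine div_le_div_of_nonneg_right ?_ hp.le
  have e : (A + B) x - (A + B) y = (A x - A y) + (B x - B y) := by
    simp only [Pi.add_apply]; ring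
  rw [e]
  exact abs_add_le _ _

theorem IsHolder.add (hA : F.IsHolder l α A) (hB : F.IsHolder l α B) :
    F.IsHolder l α (A + B) :=
  ⟨⟨_, hA.add_abs_le hB⟩, ⟨_, hA.add_quot_le hB⟩⟩

theorem IsHolder.zero : F.IsHolder l α 0 := by
  refine ⟨⟨0, ?_⟩, ⟨0, ?_⟩⟩
  · rintro _ ⟨x, rfl⟩
    simp
  · rintro _ ⟨x, y, -, -, rfl⟩
    simp

theorem IsHolder.smul (c : ℝ) (hA : F.IsHolder l α A) : F.IsHolder l α (c • A) := by
  refine ⟨⟨|c| * F.supNorm A, ?_⟩, ⟨|c| * F.holderSeminorm l α A, ?_⟩⟩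
  · rintro _ ⟨x, rfl⟩
    simp only [Pi.smul_apply, smul_eq_mul, abs_mul]
    exact mul_le_mul_of_nonneg_left (hA.abs_le x) (abs_nonneg c)
  · rintro _ ⟨x, y, h, h', rfl⟩
    simp only [Pi.smul_apply, smul_eq_mul, ← mul_sub, abs_mul, mul_div_assoc]
    exact mul_le_mul_of_nonneg_left (hA.quot_le x y h h') (abs_nonneg c)

theorem supNorm_neg : F.supNorm (-A) = F.supNorm A := by
  simp [supNorm]

theorem holderSeminorm_neg : F.holderSeminorm l α (-A) = F.holderSeminorm l α A := by
  have e : ∀ x y : F.space, |(-A) x - (-A) y| = |A x - A y| := fun x y => by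
    rw [Pi.neg_apply, Pi.neg_apply, ← abs_neg]
    congr 1
    ring
  simp only [holderSeminorm, holderQuotients, e]

variable (F l α)

/-- The space of `α`-Hölder functions, as a linear subspace of all functions. -/
def holderSubmodule : Submodule ℝ (F.space → ℝ) where
  carrier := {A | F.IsHolder l α A}
  add_mem' hA hB := IsHolder.add hA hB
  zero_mem' := IsHolder.zero
  smul_mem' c _ hA := IsHolder.smul c hA

/-- The space `C^α` of `α`-Hölder functions, to be endowed with the `α`-Hölder norm
(and not with the topology of pointwise convergence). -/
def HolderSpace : Type := F.holderSubmodule l α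

variable {F l α}

instance : AddCommGroup (F.HolderSpace l α) :=
  inferInstanceAs (AddCommGroup (F.holderSubmodule l α))

instance : Module ℝ (F.HolderSpace l α) :=
  inferInstanceAs (Module ℝ (F.holderSubmodule l α))

instance : CoeFun (F.HolderSpace l α) (fun _ => F.space → ℝ) := ⟨fun A => A.1⟩

/-- The `α`-Hölder norm `‖A‖_α = Hold_α(A) + ‖A‖₀`. -/
def holderNorm : AddGroupNorm (F.HolderSpace l α) where
  toFun A := F.holderSeminorm l α A + F.supNorm A
  map_zero' := by
    have h1 : F.holderSeminorm l α (0 : F.space → ℝ) = 0 := by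
      refine le_antisymm (Real.sSup_le ?_ le_rfl) holderSeminorm_nonneg
      rintro _ ⟨x, y, -, -, rfl⟩
      simp
    have h2 : F.supNorm (0 : F.space → ℝ) = 0 := by
      refine le_antisymm (Real.sSup_le ?_ le_rfl) supNorm_nonneg
      rintro _ ⟨x, rfl⟩
      simp
    change F.holderSeminorm l α (0 : F.space → ℝ) + F.supNorm (0 : F.space → ℝ) = 0
    rw [h1, h2, add_zero]
  add_le' A B := by
    change F.holderSeminorm l α (A.1 + B.1) + F.supNorm (A.1 + B.1) ≤ _
    have h1 : F.holderSeminorm l α (A.1 + B.1) ≤ _ :=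
      Real.sSup_le (A.2.add_quot_le B.2) (add_nonneg holderSeminorm_nonneg holderSeminorm_nonneg)
    have h2 : F.supNorm (A.1 + B.1) ≤ _ :=
      Real.sSup_le (A.2.add_abs_le B.2) (add_nonneg supNorm_nonneg supNorm_nonneg)
    linarith
  neg' A := by
    change F.holderSeminorm l α (-A.1) + F.supNorm (-A.1) = _
    rw [holderSeminorm_neg, supNorm_neg]
  eq_zero_of_map_eq_zero' A h := by
    have h1 : 0 ≤ F.holderSeminorm l α A.1 := holderSeminorm_nonneg
    have h2 : F.supNorm A.1 ≤ 0 := by linarith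
    refine Subtype.ext (funext fun x => ?_)
    exact abs_eq_zero.1 (le_antisymm ((IsHolder.abs_le A.2 x).trans h2) (abs_nonneg _))

instance : NormedAddCommGroup (F.HolderSpace l α) :=
  holderNorm.toNormedAddCommGroup

variable (F)

/-- The cylinder of the points of the subshift that begin with the word `w`. -/
def cylinder {n : ℕ} (w : Fin n → Fin q) : Set F.space :=
  {x | ∀ i : Fin n, x.1 i = w i}

/-- The partition function: the sum, over the words `w` of length `n` that occur in the subshift,
of `exp (sup_{x ∈ [w]} ∑_{k < n} A (σᵏ x))`. -/
def partitionFunction (A : F.space → ℝ) (n : ℕ) : ℝ :=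
  open Classical in
  ∑ w ∈ (Finset.univ : Finset (Fin n → Fin q)).filter (fun w => (F.cylinder w).Nonempty),
    Real.exp (sSup (birkhoffSum F.shift A n '' F.cylinder w))

/-- The topological pressure `P(A)` of a bounded function on the subshift
(for a nonempty subshift the sequence is bounded, and for continuous `A` it converges). -/
def pressure (A : F.space → ℝ) : ℝ :=
  limsup (fun n : ℕ => Real.log (F.partitionFunction A n) / n) atTop

/-- The set `C^α_0` of the `α`-Hölder functions with zero topological pressure. -/
def zeroPressure (l α : ℝ) : Set (F.HolderSpace l α) :=
  {A | F.pressure A = 0}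

/-- The shift-invariant Borel probability measures. -/
def invariantProb : Set (Measure F.space) :=
  {ν | IsProbabilityMeasure ν ∧ MeasurePreserving F.shift ν ν}

/-- The maximizing measures of `A`: the invariant probabilities at which
`ν ↦ ∫ A dν` attains its maximum over all invariant probabilities. -/
def maximizingMeasures (A : F.space → ℝ) : Set (Measure F.space) :=
  {μ | μ ∈ F.invariantProb ∧ ∀ ν ∈ F.invariantProb, ∫ x, A x ∂ν ≤ ∫ x, A x ∂μ}

/-- A set `K` is uniquely ergodic if it is forward invariant and carries exactly one
shift-invariant Borel probability. -/
def UniquelyErgodicOn (K : Set F.space) : Prop :=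
  Set.MapsTo F.shift K K ∧ ∃! ν : Measure F.space, ν ∈ F.invariantProb ∧ ν Kᶜ = 0

end SFT

end

namespace SFT

variable {q : ℕ} {F : SFT q} {l α : ℝ}

/-! Write β(A) for `maxIntegral A`; it is 1-Lipschitz in the Hölder norm. Testing A + t e against
one maximizing measure μ of A and A - t e against another, ν, gives t (∫ e dμ - ∫ e dν) ≤ β(A + t e)
+ β(A - t e) - 2 β(A). So if for every η > 0 some t > 0 makes this second difference less than t η,
all maximizing measures of A agree on e. For fixed e and η this condition is open, and it is dense
because the increments of a Lipschitz function along a line cannot keep growing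
(`exists_secondDiff_lt`). Adding a constant changes the pressure by that constant and preserves
second differences, so a perturbation can be pushed back to zero pressure. Intersecting over η =
1/(k+1) and the countably many cylinder indicators e, which are Hölder and determine a measure,
gives uniqueness on a residual set.

Unique ergodicity of the support comes from a continuous sub-action V (`exists_subaction`): the
continuous function V ∘ σ - V - (A - β(A)) is nonnegative and has integral β(A) - ∫ A dη for every
invariant η. It vanishes on supp μ, so every invariant probability carried there is maximizing,
hence equal to μ. Mixing enters through periodic shadowing, which bounds the normalized Birkhoff
sums. -/

/-! ### Topology of the subshift and variation of Hölder functions -/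

theorem shift_iterate_apply (n : ℕ) (x : F.space) (i : ℕ) :
    (F.shift^[n] x).1 i = x.1 (i + n) := by
  induction n generalizing x with
  | zero => rfl
  | succ n ih =>
    rw [Function.iterate_succ_apply, ih]
    exact congrArg x.1 (by omega)

theorem continuous_shift : Continuous F.shift :=
  continuous_induced_rng.2
    (continuous_pi fun n => (continuous_apply (n + 1)).comp continuous_subtype_val)

theorem measurable_shift : Measurable F.shift :=
  continuous_shift.measurable

theorem isClopen_cylinder {n : ℕ} (w : Fin n → Fin q) : IsClopen (F.cylinder w) := by
  have h : F.cylinder w = ⋂ i : Fin n, (fun x : F.space => x.1 i) ⁻¹' {w i} := by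
    ext x
    simp [cylinder]
  rw [h]
  exact isClopen_iInter_of_finite fun i =>
    (isClopen_discrete {w i}).preimage ((continuous_apply (i : ℕ)).comp continuous_subtype_val)

theorem isClosed_space : IsClosed F.space := by
  have h : F.space =
      ⋂ k : ℕ, (fun (x : ℕ → Fin q) (i : Fin F.window) => x (k + i)) ⁻¹' F.allowed := by
    ext x
    simp [space]
  rw [h]
  exact isClosed_iInter fun k => (isClosed_discrete F.allowed).preimage (by fun_prop)

instance : CompactSpace F.space :=
  isCompact_iff_compactSpace.1 isClosed_space.isCompact

/-- `A` varies by at most `H * t ^ k` on the sets of points with common first `k` letters. -/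
def HasVariation (H t : ℝ) (A : F.space → ℝ) : Prop :=
  ∀ x y : F.space, ∀ k : ℕ, (∀ i < k, x.1 i = y.1 i) → |A x - A y| ≤ H * t ^ k

theorem seqDist_of_ne {x y : F.space} (h : x ≠ y) :
    F.seqDist l x y = l ^ PiNat.firstDiff x.1 y.1 := by
  simp [seqDist, h]

theorem IsHolder.hasVariation {A : F.space → ℝ} (hA : F.IsHolder l α A) (hl0 : 0 < l)
    (hl1 : l < 1) (hα0 : 0 < α) : HasVariation (F.holderSeminorm l α A) (l ^ α) A := by
  intro x y k hk
  have hH : 0 ≤ F.holderSeminorm l α A := holderSeminorm_nonneg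
  have hθ : 0 < l ^ α := Real.rpow_pos_of_pos hl0 α
  by_cases hxy : x = y
  · subst hxy
    simp only [sub_self, abs_zero]
    positivity
  have hd := seqDist_of_ne (l := l) hxy
  have hpos : 0 < F.seqDist l x y := by rw [hd]; positivity
  have hle : F.seqDist l x y ≤ 1 := by rw [hd]; exact pow_le_one₀ hl0.le hl1.le
  have h1 := hA.quot_le x y hpos hle
  rw [div_le_iff₀ (Real.rpow_pos_of_pos hpos α)] at h1
  refine h1.trans (mul_le_mul_of_nonneg_left ?_ hH)
  have hk' : k ≤ PiNat.firstDiff x.1 y.1 := by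
    by_contra! hlt
    exact PiNat.apply_firstDiff_ne (fun h => hxy (Subtype.ext h)) (hk _ hlt)
  rw [hd, ← Real.rpow_natCast, ← Real.rpow_mul hl0.le, mul_comm, Real.rpow_mul hl0.le,
    Real.rpow_natCast]
  exact pow_le_pow_of_le_one hθ.le (Real.rpow_le_one hl0.le hl1.le hα0.le) hk'

theorem eventually_agree (x : F.space) (k : ℕ) : ∀ᶠ y in 𝓝 x, ∀ i < k, y.1 i = x.1 i := by
  have h : F.cylinder (fun i : Fin k => x.1 i) ∈ 𝓝 x :=
    (isClopen_cylinder _).isOpen.mem_nhds fun i => rfl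
  filter_upwards [h] with y hy i hi
  exact hy ⟨i, hi⟩

/-- The threshold `N` is there for the sub-action, whose modulus of continuity is only available
from the window length on. -/
theorem continuous_of_agree {A : F.space → ℝ} {H t : ℝ} {N : ℕ} (ht0 : 0 ≤ t) (ht1 : t < 1)
    (h : ∀ x y : F.space, ∀ k ≥ N, (∀ i < k, x.1 i = y.1 i) → |A x - A y| ≤ H * t ^ k) :
    Continuous A := by
  refine continuous_iff_continuousAt.2 fun x => Metric.tendsto_nhds.2 fun ε hε => ?_
  have hlim : Tendsto (fun k : ℕ => H * t ^ k) atTop (𝓝 (H * 0)) :=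
    (tendsto_pow_atTop_nhds_zero_of_lt_one ht0 ht1).const_mul H
  rw [mul_zero] at hlim
  obtain ⟨k, hk, hkN⟩ := ((hlim.eventually_lt_const hε).and (eventually_ge_atTop N)).exists
  filter_upwards [eventually_agree x k] with y hy
  exact (h y x k hkN hy).trans_lt hk

theorem HasVariation.continuous {A : F.space → ℝ} {H t : ℝ} (ht0 : 0 ≤ t) (ht1 : t < 1)
    (h : HasVariation H t A) : Continuous A :=
  continuous_of_agree (N := 0) ht0 ht1 fun x y k _ hk => h x y k hk

/-- The j-th iterates still agree on n - j + N letters, so the errors form a geometric series and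
the bound does not depend on n. -/
theorem HasVariation.abs_birkhoffSum_sub_le {A : F.space → ℝ} {H t : ℝ} (hH : 0 ≤ H)
    (ht0 : 0 ≤ t) (ht1 : t < 1) (h : HasVariation H t A) (N n : ℕ) (x y : F.space)
    (hxy : ∀ i < n + N, x.1 i = y.1 i) :
    |birkhoffSum F.shift A n x - birkhoffSum F.shift A n y| ≤ H / (1 - t) * t ^ N := by
  have h1 : |birkhoffSum F.shift A n x - birkhoffSum F.shift A n y| ≤
      ∑ j ∈ Finset.range n, H * t ^ (n - j + N) := by
    rw [birkhoffSum, birkhoffSum, ← Finset.sum_sub_distrib]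
    refine (Finset.abs_sum_le_sum_abs _ _).trans (Finset.sum_le_sum fun j hj => ?_)
    rw [Finset.mem_range] at hj
    refine h _ _ _ fun i hi => ?_
    rw [shift_iterate_apply, shift_iterate_apply]
    exact hxy _ (by omega)
  refine h1.trans ?_
  have h2 : ∀ n : ℕ, ∑ j ∈ Finset.range n, H * t ^ (n - j + N) ≤ H * t ^ N * (1 - t)⁻¹ := by
    intro n
    have h3 : ∑ j ∈ Finset.range n, H * t ^ (n - j + N) =
        H * t ^ N * ∑ j ∈ Finset.range n, t ^ (j + 1) := by
      rw [Finset.mul_sum, ← Finset.sum_range_reflect]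
      refine Finset.sum_congr rfl fun j hj => ?_
      rw [Finset.mem_range] at hj
      rw [show n - (n - 1 - j) = j + 1 by omega, pow_add]
      ring
    rw [h3]
    refine mul_le_mul_of_nonneg_left ?_ (by positivity)
    rw [← tsum_geometric_of_lt_one ht0 ht1]
    refine le_trans (Finset.sum_le_sum fun j _ => ?_)
      ((summable_geometric_of_lt_one ht0 ht1).sum_le_tsum (Finset.range n)
        fun i _ => pow_nonneg ht0 i)
    exact pow_le_pow_of_le_one ht0 ht1.le (Nat.le_succ j)
  refine (h2 n).trans (le_of_eq ?_)
  rw [div_eq_mul_inv]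
  ring

/-! ### Periodic orbits and maximizing measures -/

/-- Every orbit segment is shadowed by a periodic orbit whose period exceeds the length of the
segment by a fixed amount. -/
theorem exists_periodic_shadowing (hmix : F.TopologicallyMixing) :
    ∃ N : ℕ, 0 < N ∧ ∀ (y : F.space) (n : ℕ), ∃ p : F.space,
      F.shift^[n + N] p = p ∧ ∀ i < n, p.1 i = y.1 i := by
  have hgap : ∀ uv : (Fin F.window → Fin q) × (Fin F.window → Fin q), ∃ N : ℕ,
      (F.cylinder uv.1).Nonempty → (F.cylinder uv.2).Nonempty → ∀ n ≥ N,
        (F.cylinder uv.1 ∩ F.shift^[n] ⁻¹' F.cylinder uv.2).Nonempty := by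
    intro uv
    by_cases h : (F.cylinder uv.1).Nonempty ∧ (F.cylinder uv.2).Nonempty
    · obtain ⟨N, hN⟩ := hmix _ _ (isClopen_cylinder uv.1).isOpen (isClopen_cylinder uv.2).isOpen
        h.1 h.2
      exact ⟨N, fun _ _ => hN⟩
    · exact ⟨0, fun h1 h2 => absurd ⟨h1, h2⟩ h⟩
  choose g hg using hgap
  -- There are finitely many pairs of window words, so one gap serves all of them; N also exceeds
  -- the window, so a window meets the seam of the periodic word at most once.
  set N := Finset.univ.sup g + F.window + 1 with hN
  refine ⟨N, by omega, fun y n => ?_⟩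
  -- z continues y after time n and returns to the initial window of y at time N; repeating
  -- y₀…yₙ₋₁z₀…z_{N-1} then closes up.
  obtain ⟨z, hz1, hz2⟩ := hg (fun i => y.1 (n + i), fun i => y.1 i)
    ⟨F.shift^[n] y, fun i => by rw [shift_iterate_apply, add_comm]⟩ ⟨y, fun i => rfl⟩ N
    (by
      have := Finset.le_sup (f := g) (Finset.mem_univ
        ((fun i : Fin F.window => y.1 (n + i)), (fun i : Fin F.window => y.1 i)))
      omega)
  have hzy : ∀ i < F.window, z.1 i = y.1 (n + i) := fun i hi => hz1 ⟨i, hi⟩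
  have hzN : ∀ i < F.window, z.1 (i + N) = y.1 i := fun i hi => by
    rw [← shift_iterate_apply]
    exact hz2 ⟨i, hi⟩
  let r : ℕ → Fin q := fun i => if i < n then y.1 i else z.1 (i - n)
  have hr1 : ∀ i < n + F.window, r i = y.1 i := by
    intro i hi
    by_cases hin : i < n
    · simp [r, hin]
    · simp only [r, hin, if_false]
      rw [hzy _ (by omega)]
      exact congrArg y.1 (by omega)
  have hr2 : ∀ i, n ≤ i → r i = z.1 (i - n) := fun i hi => by simp [r, not_lt.2 hi]
  let p : ℕ → Fin q := fun i => r (i % (n + N))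
  have hp1 : ∀ i < n + F.window, p i = y.1 i := by
    intro i hi
    simp only [p]
    rw [Nat.mod_eq_of_lt (by omega), hr1 i hi]
  have hp2 : ∀ i, n ≤ i → i < n + N + F.window → p i = z.1 (i - n) := by
    intro i hi hi2
    simp only [p]
    by_cases hlt : i < n + N
    · rw [Nat.mod_eq_of_lt hlt, hr2 i hi]
    · rw [Nat.mod_eq_sub_mod (not_lt.1 hlt), Nat.mod_eq_of_lt (by omega), hr1 _ (by omega),
        ← hzN _ (by omega)]
      exact congrArg z.1 (by omega)
  have hper : ∀ i, p (i + (n + N)) = p i := fun i => by simp [p]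
  have hmem : p ∈ F.space := by
    intro k
    have hk : k % (n + N) < n + N := Nat.mod_lt _ (by omega)
    have hshift : ∀ i, p (k + i) = p (k % (n + N) + i) := fun i => by
      simp only [p, Nat.mod_add_mod]
    simp only [hshift]
    -- Up to periodicity, a window starting before n is a window of y, and any other is a window of
    -- z.
    by_cases hkn : k % (n + N) < n
    · have e : (fun i : Fin F.window => p (k % (n + N) + i)) =
          fun i : Fin F.window => y.1 (k % (n + N) + i) :=
        funext fun i => hp1 _ (by omega)
      rw [e]
      exact y.2 _
    · have e : (fun i : Fin F.window => p (k % (n + N) + i)) =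
          fun i : Fin F.window => z.1 (k % (n + N) - n + i) :=
        funext fun i => by
          rw [hp2 _ (by omega) (by omega)]
          exact congrArg z.1 (by omega)
      rw [e]
      exact z.2 _
  refine ⟨⟨p, hmem⟩, Subtype.ext (funext fun i => ?_), fun i hi => hp1 i (by omega)⟩
  rw [shift_iterate_apply]
  exact hper i

/-- The uniform probability on a periodic orbit is invariant. -/
theorem exists_invariantProb_of_periodic {p : F.space} {T : ℕ} (hT : 0 < T)
    (hp : F.shift^[T] p = p) :
    ∃ ν ∈ F.invariantProb, ∀ A : F.space → ℝ, Continuous A →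
      ∫ x, A x ∂ν = birkhoffSum F.shift A T p / T := by
  have hT' : (T : ENNReal) ≠ 0 := by exact_mod_cast hT.ne'
  let ν : Measure F.space :=
    (T : ENNReal)⁻¹ • ∑ i ∈ Finset.range T, Measure.dirac (F.shift^[i] p)
  have hν : IsProbabilityMeasure ν := by
    refine ⟨?_⟩
    simp [ν, ENNReal.inv_mul_cancel hT' (ENNReal.natCast_ne_top T)]
  refine ⟨ν, ⟨hν, measurable_shift, ?_⟩, fun A hA => ?_⟩
  · ext s hs
    rw [Measure.map_apply measurable_shift hs]
    simp only [ν, Measure.smul_apply, Measure.coe_finsetSum, Finset.sum_apply,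
      Measure.dirac_apply' _ hs, Measure.dirac_apply' _ (measurable_shift hs)]
    congr 1
    have h1 : ∀ i, (F.shift ⁻¹' s).indicator (1 : F.space → ENNReal) (F.shift^[i] p) =
        s.indicator 1 (F.shift^[i + 1] p) := fun i => by
      rw [Function.iterate_succ_apply']
      rfl
    simp only [h1]
    -- Splitting off the first or the last term of the same sum gives equal terms, since the orbit
    -- closes up at time T; the common term is finite and cancels.
    have h2 := Finset.sum_range_succ (fun i => s.indicator (1 : F.space → ENNReal) (F.shift^[i] p)) T
    rw [Finset.sum_range_succ', hp] at h2
    refine (ENNReal.add_left_inj ?_).1 h2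
    exact ne_top_of_le_ne_top ENNReal.one_ne_top (Set.indicator_le_self' (by simp) _)
  · rw [integral_smul_measure, integral_finsetSum_measure]
    · simp only [integral_dirac, birkhoffSum, smul_eq_mul]
      rw [ENNReal.toReal_inv, ENNReal.toReal_natCast, div_eq_inv_mul]
    · intro i _
      exact integrable_dirac (by simp)

theorem integrable_of_continuous {A : F.space → ℝ} (hA : Continuous A) (ν : Measure F.space)
    [IsFiniteMeasure ν] : Integrable A ν :=
  (BoundedContinuousFunction.mkOfCompact ⟨A, hA⟩).integrable ν

theorem invariantProb_nonempty (hne : F.space.Nonempty) (hmix : F.TopologicallyMixing) :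
    F.invariantProb.Nonempty := by
  obtain ⟨x, hx⟩ := hne
  obtain ⟨N, hN, h⟩ := exists_periodic_shadowing hmix
  obtain ⟨p, hp, -⟩ := h ⟨x, hx⟩ 0
  obtain ⟨ν, hν, -⟩ := exists_invariantProb_of_periodic (by omega) hp
  exact ⟨ν, hν⟩

/-- The invariant probabilities form a weak-* closed subset of a compact space, nonempty thanks to
periodic orbits, and the integral of A is weak-* continuous. -/
theorem maximizingMeasures_nonempty (hne : F.space.Nonempty) (hmix : F.TopologicallyMixing)
    {A : F.space → ℝ} (hA : Continuous A) : (F.maximizingMeasures A).Nonempty := by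
  let S : Set (ProbabilityMeasure F.space) :=
    {ν | ν.map measurable_shift.aemeasurable = ν}
  have hS : IsCompact S :=
    (isClosed_eq (ProbabilityMeasure.continuous_map continuous_shift) continuous_id).isCompact
  have hiff : ∀ ν : ProbabilityMeasure F.space, ν ∈ S ↔ (ν : Measure F.space) ∈ F.invariantProb := by
    intro ν
    constructor
    · intro h
      exact ⟨inferInstance, measurable_shift, congrArg Subtype.val h⟩
    · intro h
      exact Subtype.ext h.2.map_eq
  have hSne : S.Nonempty := by
    obtain ⟨ν, hν⟩ := invariantProb_nonempty hne hmix
    exact ⟨⟨ν, hν.1⟩, (hiff ⟨ν, hν.1⟩).2 hν⟩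
  obtain ⟨μ, hμ, hmax⟩ := hS.exists_isMaxOn hSne
    (ProbabilityMeasure.continuous_integral_boundedContinuousFunction
      (BoundedContinuousFunction.mkOfCompact ⟨A, hA⟩)).continuousOn
  exact ⟨μ, (hiff μ).1 hμ, fun ν hν => hmax ((hiff ⟨ν, hν.1⟩).2 hν)⟩

variable (F) in
/-- The supremum of the integrals of `A` over the invariant probabilities. -/
noncomputable def maxIntegral (A : F.space → ℝ) : ℝ :=
  sSup ((fun ν : Measure F.space => ∫ x, A x ∂ν) '' F.invariantProb)

theorem integral_eq_maxIntegral {A : F.space → ℝ} {μ : Measure F.space}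
    (hμ : μ ∈ F.maximizingMeasures A) : ∫ x, A x ∂μ = F.maxIntegral A := by
  have h : IsGreatest ((fun ν : Measure F.space => ∫ x, A x ∂ν) '' F.invariantProb)
      (∫ x, A x ∂μ) := by
    refine ⟨⟨μ, hμ.1, rfl⟩, ?_⟩
    rintro _ ⟨ν, hν, rfl⟩
    exact hμ.2 ν hν
  exact h.csSup_eq.symm

theorem integral_le_maxIntegral (hne : F.space.Nonempty) (hmix : F.TopologicallyMixing)
    {A : F.space → ℝ} (hA : Continuous A) {ν : Measure F.space} (hν : ν ∈ F.invariantProb) :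
    ∫ x, A x ∂ν ≤ F.maxIntegral A := by
  obtain ⟨μ, hμ⟩ := maximizingMeasures_nonempty hne hmix hA
  exact (hμ.2 ν hν).trans_eq (integral_eq_maxIntegral hμ)

theorem mem_maximizingMeasures_iff (hne : F.space.Nonempty) (hmix : F.TopologicallyMixing)
    {A : F.space → ℝ} (hA : Continuous A) {ν : Measure F.space} (hν : ν ∈ F.invariantProb) :
    ν ∈ F.maximizingMeasures A ↔ ∫ x, A x ∂ν = F.maxIntegral A :=
  ⟨integral_eq_maxIntegral,
    fun h => ⟨hν, fun _ hη => (integral_le_maxIntegral hne hmix hA hη).trans_eq h.symm⟩⟩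

/-- This one comparison yields both the Lipschitz bound for `maxIntegral` and its behaviour under
adding constants. -/
theorem maxIntegral_le_add (hne : F.space.Nonempty) (hmix : F.TopologicallyMixing)
    {A B : F.space → ℝ} (hA : Continuous A) (hB : Continuous B) {c : ℝ}
    (h : ∀ x, A x ≤ B x + c) : F.maxIntegral A ≤ F.maxIntegral B + c := by
  obtain ⟨μ, hμ⟩ := maximizingMeasures_nonempty hne hmix hA
  have := hμ.1.1
  rw [← integral_eq_maxIntegral hμ]
  calc ∫ x, A x ∂μ ≤ ∫ x, (B x + c) ∂μ :=
        integral_mono (integrable_of_continuous hA μ)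
          ((integrable_of_continuous hB μ).add (integrable_const c)) h
    _ = ∫ x, B x ∂μ + c := by
        rw [integral_add (integrable_of_continuous hB μ) (integrable_const c)]
        simp
    _ ≤ F.maxIntegral B + c := by
        gcongr
        exact integral_le_maxIntegral hne hmix hB hμ.1

theorem HasVariation.sub_const {A : F.space → ℝ} {H t : ℝ} (h : HasVariation H t A) (c : ℝ) :
    HasVariation H t (fun x => A x - c) := fun x y k hk => by
  simpa using h x y k hk

theorem birkhoffSum_sub_const (A : F.space → ℝ) (c : ℝ) (n : ℕ) (x : F.space) :
    birkhoffSum F.shift (fun x => A x - c) n x = birkhoffSum F.shift A n x - n * c := by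
  simp [birkhoffSum]

/-! ### Sub-actions and the subordination principle -/

/-- The Birkhoff sums of the normalized function `A - maxIntegral A` are bounded above. -/
theorem exists_birkhoffSum_le (hne : F.space.Nonempty) (hmix : F.TopologicallyMixing)
    {A : F.space → ℝ} {H t : ℝ} (hH : 0 ≤ H) (ht0 : 0 ≤ t) (ht1 : t < 1)
    (hA : HasVariation H t A) :
    ∃ C : ℝ, ∀ (n : ℕ) (y : F.space),
      birkhoffSum F.shift (fun x => A x - F.maxIntegral A) n y ≤ C := by
  obtain ⟨N, hN, hper⟩ := exists_periodic_shadowing hmix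
  set m := F.maxIntegral A
  have hc : Continuous A := hA.continuous ht0 ht1
  obtain ⟨D, hD⟩ := (isCompact_range (f := fun x => |A x - m|)
    (hc.sub continuous_const).abs).bddAbove
  have hD' : ∀ x, |A x - m| ≤ D := fun x => hD ⟨x, rfl⟩
  -- The first term is the cost of passing from y to a shadowing periodic point p, the second that
  -- of the N closing letters; the normalized sum over the full period of p is at most 0.
  refine ⟨H / (1 - t) + N * D, fun n y => ?_⟩
  obtain ⟨p, hp, hpy⟩ := hper y n
  obtain ⟨ν, hν, hint⟩ := exists_invariantProb_of_periodic (by omega) hp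
  have h1 : birkhoffSum F.shift A (n + N) p ≤ (n + N : ℕ) * m := by
    have h := integral_le_maxIntegral hne hmix hc hν
    rw [hint A hc, div_le_iff₀ (by exact_mod_cast (by omega : 0 < n + N))] at h
    rwa [mul_comm]
  have h2 : birkhoffSum F.shift (fun x => A x - m) (n + N) p ≤ 0 := by
    rw [birkhoffSum_sub_const]
    linarith
  rw [birkhoffSum_add] at h2
  have h3 : -(N * D) ≤ birkhoffSum F.shift (fun x => A x - m) N (F.shift^[n] p) := by
    have h := Finset.sum_le_sum (s := Finset.range N) (f := fun _ => -D)
      (g := fun k => (fun x => A x - m) (F.shift^[k] (F.shift^[n] p)))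
      fun k _ => (abs_le.1 (hD' _)).1
    simpa [birkhoffSum] using h
  have h4 := (abs_le.1 ((hA.sub_const m).abs_birkhoffSum_sub_le hH ht0 ht1 0 n y p
    (fun i hi => (hpy i (by omega)).symm))).2
  rw [pow_zero, mul_one] at h4
  linarith

/-- Replacing the tail `F.shift^[n] y` of a point by a nearby point of the subshift. -/
theorem exists_replace_tail (n : ℕ) (y x' : F.space) {k : ℕ} (hk : F.window ≤ k)
    (h : ∀ i < k, (F.shift^[n] y).1 i = x'.1 i) :
    ∃ y' : F.space, F.shift^[n] y' = x' ∧ ∀ i < n + k, y.1 i = y'.1 i := by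
  let z : ℕ → Fin q := fun i => if i < n then y.1 i else x'.1 (i - n)
  have hz1 : ∀ i < n + k, z i = y.1 i := by
    intro i hi
    by_cases hin : i < n
    · simp [z, hin]
    · simp only [z, hin, if_false]
      rw [← h _ (by omega), shift_iterate_apply]
      exact congrArg y.1 (by omega)
  have hz2 : ∀ i, n ≤ i → z i = x'.1 (i - n) := fun i hi => by simp [z, not_lt.2 hi]
  -- Windows starting before n lie within the first n + k letters, where z agrees with y, because
  -- the window is at most k; later windows lie in x'.
  have hmem : z ∈ F.space := by
    intro j
    by_cases hj : j < n
    · have e : (fun i : Fin F.window => z (j + i)) = fun i : Fin F.window => y.1 (j + i) :=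
        funext fun i => hz1 _ (by omega)
      rw [e]
      exact y.2 j
    · have e : (fun i : Fin F.window => z (j + i)) =
          fun i : Fin F.window => x'.1 (j - n + i) :=
        funext fun i => by
          rw [hz2 _ (by omega)]
          exact congrArg x'.1 (by omega)
      rw [e]
      exact x'.2 _
  refine ⟨⟨z, hmem⟩, Subtype.ext (funext fun i => ?_), fun i hi => (hz1 i hi).symm⟩
  rw [shift_iterate_apply]
  change z (i + n) = _
  rw [hz2 _ (by omega)]
  exact congrArg x'.1 (by omega)

/-- **Mañé's lemma**: there is a continuous sub-action. -/
theorem exists_subaction (hne : F.space.Nonempty) (hmix : F.TopologicallyMixing)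
    {A : F.space → ℝ} {H t : ℝ} (hH : 0 ≤ H) (ht0 : 0 ≤ t) (ht1 : t < 1)
    (hA : HasVariation H t A) :
    ∃ V : F.space → ℝ, Continuous V ∧ ∀ x, A x - F.maxIntegral A + V x ≤ V (F.shift x) := by
  obtain ⟨C, hC⟩ := exists_birkhoffSum_le hne hmix hH ht0 ht1 hA
  set B : F.space → ℝ := fun x => A x - F.maxIntegral A with hB
  have hBvar : HasVariation H t B := hA.sub_const _
  -- V(x) is the supremum of normalized Birkhoff sums over all finite backward orbits ending at x,
  -- the empty one included.
  let S : F.space → Set ℝ := fun x =>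
    {r | ∃ (n : ℕ) (y : F.space), F.shift^[n] y = x ∧ r = birkhoffSum F.shift B n y}
  have hbdd : ∀ x, BddAbove (S x) := fun x => ⟨C, by
    rintro _ ⟨n, y, -, rfl⟩
    exact hC n y⟩
  have hSne : ∀ x, (S x).Nonempty := fun x => ⟨_, 0, x, rfl, rfl⟩
  -- A backward orbit ending at x can be transplanted to one ending at x', at the cost given by
  -- bounded variation.
  have hle : ∀ x x' : F.space, ∀ k ≥ F.window, (∀ i < k, x.1 i = x'.1 i) →
      sSup (S x) ≤ sSup (S x') + H / (1 - t) * t ^ k := by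
    intro x x' k hk hxx'
    refine csSup_le (hSne x) ?_
    rintro _ ⟨n, y, rfl, rfl⟩
    obtain ⟨y', hy', hyy'⟩ := exists_replace_tail n y x' hk hxx'
    have h1 := (abs_le.1 (hBvar.abs_birkhoffSum_sub_le hH ht0 ht1 k n y y' hyy')).2
    have h2 : birkhoffSum F.shift B n y' ≤ sSup (S x') := le_csSup (hbdd x') ⟨n, y', hy', rfl⟩
    linarith
  refine ⟨fun x => sSup (S x), ?_, fun x => ?_⟩
  · refine continuous_of_agree (N := F.window) (H := H / (1 - t)) ht0 ht1 fun x y k hk hxy => ?_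
    have h1 := hle x y k hk hxy
    have h2 := hle y x k hk fun i hi => (hxy i hi).symm
    exact abs_le.2 ⟨by linarith, by linarith⟩
  -- Appending x to a backward orbit ending at x gives one ending at σ x.
  · change B x + sSup (S x) ≤ _
    rw [← le_sub_iff_add_le']
    refine csSup_le (hSne x) ?_
    rintro _ ⟨n, y, hy, rfl⟩
    rw [le_sub_iff_add_le', add_comm]
    refine le_csSup (hbdd _) ⟨n + 1, y, ?_, ?_⟩
    · rw [Function.iterate_succ_apply', hy]
    · rw [birkhoffSum_succ, hy]

/-- **Subordination principle**: an invariant probability carried by the support of a maximizing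
measure is maximizing. -/
theorem mem_maximizingMeasures_of_support (hne : F.space.Nonempty) (hmix : F.TopologicallyMixing)
    {A : F.space → ℝ} {H t : ℝ} (hH : 0 ≤ H) (ht0 : 0 ≤ t) (ht1 : t < 1)
    (hA : HasVariation H t A) {μ ν : Measure F.space} (hμ : μ ∈ F.maximizingMeasures A)
    (hν : ν ∈ F.invariantProb) (hνμ : ν μ.supportᶜ = 0) : ν ∈ F.maximizingMeasures A := by
  obtain ⟨V, hV, hVA⟩ := exists_subaction hne hmix hH ht0 ht1 hA
  have hc := hA.continuous ht0 ht1
  set g : F.space → ℝ := fun x => V (F.shift x) - V x - (A x - F.maxIntegral A) with hg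
  have hVs : Continuous fun x => V (F.shift x) := hV.comp continuous_shift
  have hgc : Continuous g := (hVs.sub hV).sub (hc.sub continuous_const)
  have hg0 : ∀ x, 0 ≤ g x := fun x => by
    have := hVA x
    simp only [hg]
    linarith
  have hint : ∀ η ∈ F.invariantProb, ∫ x, g x ∂η = F.maxIntegral A - ∫ x, A x ∂η := by
    intro η hη
    have := hη.1
    have h1 : ∫ x, V (F.shift x) ∂η = ∫ x, V x ∂η := by
      have h := integral_map (μ := η) (φ := F.shift) measurable_shift.aemeasurable
        (f := V) hV.aestronglyMeasurable
      rw [hη.2.map_eq] at h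
      exact h.symm
    simp only [hg]
    have i1 : Integrable (fun x => V (F.shift x) - V x) η :=
      integrable_of_continuous (hVs.sub hV) η
    have i2 : Integrable (fun x => A x - F.maxIntegral A) η :=
      integrable_of_continuous (hc.sub continuous_const) η
    rw [integral_sub i1 i2,
      integral_sub (integrable_of_continuous hVs η) (integrable_of_continuous hV η),
      integral_sub (integrable_of_continuous hc η) (integrable_const _), h1]
    simp
  have := hμ.1.1
  have := hν.1
  have hgμ : g =ᵐ[μ] 0 := by
    rw [← integral_eq_zero_iff_of_nonneg hg0 (integrable_of_continuous hgc μ), hint μ hμ.1,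
      integral_eq_maxIntegral hμ, sub_self]
  -- The zero set of g is closed and has full μ-measure, so it contains the support.
  have hzero : ∀ x ∈ μ.support, g x = 0 :=
    Measure.support_subset_of_isClosed (isClosed_eq hgc continuous_const) hgμ
  have hgν : g =ᵐ[ν] 0 := by
    have hae : ∀ᵐ x ∂ν, x ∈ μ.support := hνμ
    filter_upwards [hae] with x hx using hzero x hx
  rw [mem_maximizingMeasures_iff hne hmix hc hν]
  have h := hint ν hν
  rw [integral_congr_ae hgν] at h
  simp at h
  linarith

/-- By invariance, the preimage of an open neighbourhood of σ x has the same measure, which is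
positive because it is a neighbourhood of x. -/
theorem mapsTo_shift_support {μ : Measure F.space} (hμ : μ ∈ F.invariantProb) :
    Set.MapsTo F.shift μ.support μ.support := by
  intro x hx
  rw [Measure.mem_support_iff_forall] at hx ⊢
  intro U hU
  obtain ⟨W, hWU, hW, hxW⟩ := mem_nhds_iff.1 hU
  have h := hx _ (continuous_shift.continuousAt.preimage_mem_nhds (hW.mem_nhds hxW))
  rw [hμ.2.measure_preimage hW.measurableSet.nullMeasurableSet] at h
  exact h.trans_le (measure_mono hWU)

/-! ### Cylinders determine measures -/

/-- A Borel probability is determined by its values on cylinders. -/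
theorem ext_of_cylinder {μ ν : Measure F.space} [IsProbabilityMeasure μ] [IsProbabilityMeasure ν]
    (h : ∀ (n : ℕ) (w : Fin n → Fin q), μ (F.cylinder w) = ν (F.cylinder w)) : μ = ν := by
  let 𝒞 : Set (Set F.space) := {s | ∃ (n : ℕ) (w : Fin n → Fin q), s = F.cylinder w}
  have hpi : IsPiSystem 𝒞 := by
    rintro _ ⟨n, v, rfl⟩ _ ⟨k, w, rfl⟩ ⟨x, hxv, hxw⟩
    -- Two cylinders with a common point x meet in the cylinder of the longer initial word of x.
    refine ⟨max n k, fun i => x.1 i, Set.ext fun y => ⟨fun hy i => ?_, fun hy => ⟨fun i => ?_, fun i => ?_⟩⟩⟩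
    · rcases lt_max_iff.1 i.2 with hi | hi
      · exact (hy.1 ⟨i, hi⟩).trans (hxv ⟨i, hi⟩).symm
      · exact (hy.2 ⟨i, hi⟩).trans (hxw ⟨i, hi⟩).symm
    · exact (hy ⟨i, lt_max_of_lt_left i.2⟩).trans (hxv i)
    · exact (hy ⟨i, lt_max_of_lt_right i.2⟩).trans (hxw i)
  have hgen : (inferInstance : MeasurableSpace F.space) = MeasurableSpace.generateFrom 𝒞 := by
    refine le_antisymm ?_ (MeasurableSpace.generateFrom_le ?_)
    · have hid : @Measurable _ _ (MeasurableSpace.generateFrom 𝒞) MeasurableSpace.pi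
          (Subtype.val : F.space → ℕ → Fin q) := by
        refine @measurable_pi_lambda _ _ _ (_) _ _ fun n => ?_
        refine @measurable_to_countable' _ _ _ _ (_) _ fun a => ?_
        have e : (fun x : F.space => x.1 n) ⁻¹' {a} =
            ⋃ w ∈ {w : Fin (n + 1) → Fin q | w (Fin.last n) = a}, F.cylinder w := by
          ext x
          simp only [Set.mem_preimage, Set.mem_singleton_iff, Set.mem_iUnion, Set.mem_ofPred_eq,
            exists_prop]
          constructor
          · intro hx
            exact ⟨fun i => x.1 i, by simpa using hx, fun i => rfl⟩
          · rintro ⟨w, hw, hx⟩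
            rw [← hw]
            simpa using hx (Fin.last n)
        rw [e]
        exact MeasurableSet.biUnion (Set.to_countable _) fun w _ =>
          MeasurableSpace.measurableSet_generateFrom ⟨n + 1, w, rfl⟩
      exact hid.comap_le
    · rintro _ ⟨n, w, rfl⟩
      exact (isClopen_cylinder w).isOpen.measurableSet
  refine ext_of_generate_finite 𝒞 hgen hpi ?_ (by simp)
  rintro _ ⟨n, w, rfl⟩
  exact h n w

/-! ### Estimates for the pressure -/

theorem abs_birkhoffSum_le {A : F.space → ℝ} {D : ℝ} (hD : ∀ x, |A x| ≤ D) (n : ℕ) (x : F.space) :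
    |birkhoffSum F.shift A n x| ≤ n * D := by
  refine (Finset.abs_sum_le_sum_abs _ _).trans ?_
  simpa using Finset.sum_le_sum (s := Finset.range n) fun k _ => hD (F.shift^[k] x)

theorem partitionFunction_pos (hne : F.space.Nonempty) (A : F.space → ℝ) (n : ℕ) :
    0 < F.partitionFunction A n := by
  obtain ⟨x, hx⟩ := hne
  refine Finset.sum_pos (fun w _ => Real.exp_pos _) ⟨fun i => x i, ?_⟩
  simp only [Finset.mem_filter, Finset.mem_univ, true_and]
  exact ⟨⟨x, hx⟩, fun i => rfl⟩

/-- The bound on B keeps its suprema genuine, as `sSup` of an unbounded set of reals is 0. -/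
theorem partitionFunction_le {A B : F.space → ℝ} {D c : ℝ} (hD : ∀ x, |B x| ≤ D)
    (h : ∀ x, A x ≤ B x + c) (n : ℕ) :
    F.partitionFunction A n ≤ Real.exp (n * c) * F.partitionFunction B n := by
  classical
  rw [partitionFunction, partitionFunction, Finset.mul_sum]
  refine Finset.sum_le_sum fun w hw => ?_
  rw [← Real.exp_add, Real.exp_le_exp]
  refine csSup_le ((Finset.mem_filter.1 hw).2.image _) ?_
  rintro _ ⟨x, hx, rfl⟩
  have hbdd : BddAbove (birkhoffSum F.shift B n '' F.cylinder w) := ⟨n * D, by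
    rintro _ ⟨y, -, rfl⟩
    exact (abs_le.1 (abs_birkhoffSum_le hD n y)).2⟩
  have h1 : birkhoffSum F.shift A n x ≤ birkhoffSum F.shift B n x + n * c := by
    simpa [birkhoffSum, Finset.sum_add_distrib] using
      Finset.sum_le_sum (s := Finset.range n) fun k _ => h (F.shift^[k] x)
  have h2 := le_csSup hbdd ⟨x, hx, rfl⟩
  linarith

theorem log_partitionFunction_div_le (hne : F.space.Nonempty) {A B : F.space → ℝ} {D c : ℝ}
    (hD : ∀ x, |B x| ≤ D) (h : ∀ x, A x ≤ B x + c) {n : ℕ} (hn : 0 < n) :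
    Real.log (F.partitionFunction A n) / n ≤ Real.log (F.partitionFunction B n) / n + c := by
  have hn' : (0 : ℝ) < n := by exact_mod_cast hn
  have h1 := Real.log_le_log (partitionFunction_pos hne A n) (partitionFunction_le hD h n)
  rw [Real.log_mul (Real.exp_pos _).ne' (partitionFunction_pos hne B n).ne', Real.log_exp] at h1
  rw [div_add' _ _ _ hn'.ne', div_le_div_iff_of_pos_right hn']
  linarith

/-- For the zero function the partition function counts the occurring words of length n: at least 1
and at most q ^ n. -/
theorem log_partitionFunction_zero_mem (hne : F.space.Nonempty) {n : ℕ} (hn : 0 < n) :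
    Real.log (F.partitionFunction 0 n) / n ∈ Set.Icc 0 (Real.log q) := by
  classical
  have hn' : (0 : ℝ) < n := by exact_mod_cast hn
  have hcard : F.partitionFunction 0 n =
      ((Finset.univ.filter fun w : Fin n → Fin q => (F.cylinder w).Nonempty).card : ℝ) := by
    rw [partitionFunction, Finset.card_eq_sum_ones, Nat.cast_sum]
    refine Finset.sum_congr (by congr) fun w hw => ?_
    have hw' : (F.cylinder w).Nonempty := (Finset.mem_filter.1 hw).2
    have h0 : birkhoffSum F.shift (0 : F.space → ℝ) n = fun _ => 0 := by
      ext x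
      simp [birkhoffSum]
    rw [h0, hw'.image_const]
    simp
  have hpos := partitionFunction_pos hne (0 : F.space → ℝ) n
  constructor
  · refine div_nonneg (Real.log_nonneg ?_) hn'.le
    rw [hcard] at hpos ⊢
    exact_mod_cast hpos
  · rw [div_le_iff₀ hn', mul_comm, ← Real.log_pow]
    refine Real.log_le_log hpos ?_
    rw [hcard]
    have h := Finset.card_le_univ
      (Finset.univ.filter fun w : Fin n → Fin q => (F.cylinder w).Nonempty)
    rw [Fintype.card_fun, Fintype.card_fin, Fintype.card_fin] at h
    exact_mod_cast h

theorem log_partitionFunction_div_mem (hne : F.space.Nonempty) {A : F.space → ℝ} {D : ℝ}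
    (hD : ∀ x, |A x| ≤ D) {n : ℕ} (hn : 0 < n) :
    Real.log (F.partitionFunction A n) / n ∈ Set.Icc (-D) (Real.log q + D) := by
  have h0 := log_partitionFunction_zero_mem hne hn
  have h1 := log_partitionFunction_div_le hne (A := A) (B := 0) (D := 0) (c := D) (by simp)
    (fun x => by simpa using (abs_le.1 (hD x)).2) hn
  have h2 := log_partitionFunction_div_le hne (A := 0) (B := A) (D := D) (c := D) hD
    (fun x => by
      have := (abs_le.1 (hD x)).1
      simp only [Pi.zero_apply]
      linarith) hn
  exact ⟨by linarith [h0.1], by linarith [h0.2]⟩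

theorem pressure_le_add (hne : F.space.Nonempty) {A B : F.space → ℝ} {D E c : ℝ}
    (hA : ∀ x, |A x| ≤ D) (hB : ∀ x, |B x| ≤ E) (h : ∀ x, A x ≤ B x + c) :
    F.pressure A ≤ F.pressure B + c := by
  -- Comparing real `limsup`s requires two-sided bounds; convergence of the sequence is never
  -- needed.
  have hbdd : ∀ {A : F.space → ℝ} {D : ℝ}, (∀ x, |A x| ≤ D) →
      IsBoundedUnder (· ≤ ·) atTop (fun n : ℕ => Real.log (F.partitionFunction A n) / n) ∧
      IsCoboundedUnder (· ≤ ·) atTop (fun n : ℕ => Real.log (F.partitionFunction A n) / n) := by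
    intro A D hA
    constructor
    · refine isBoundedUnder_of_eventually_le (a := Real.log q + D) ?_
      filter_upwards [eventually_gt_atTop 0] with n hn
        using (log_partitionFunction_div_mem hne hA hn).2
    · refine IsBoundedUnder.isCoboundedUnder_le (isBoundedUnder_of_eventually_ge (a := -D) ?_)
      filter_upwards [eventually_gt_atTop 0] with n hn
        using (log_partitionFunction_div_mem hne hA hn).1
  rw [pressure, pressure, ← limsup_add_const atTop _ c (hbdd hB).1 (hbdd hB).2]
  refine limsup_le_limsup ?_ (hbdd hA).2 ?_
  · filter_upwards [eventually_gt_atTop 0] with n hn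
      using log_partitionFunction_div_le hne hB h hn
  · refine isBoundedUnder_of_eventually_le (a := Real.log q + E + c) ?_
    filter_upwards [eventually_gt_atTop 0] with n hn
    have := (log_partitionFunction_div_mem hne hB hn).2
    linarith

/-! ### The Hölder space: norm estimates, constants, cylinder indicators -/

theorem HolderSpace.norm_def (A : F.HolderSpace l α) :
    ‖A‖ = F.holderSeminorm l α A + F.supNorm A :=
  rfl

theorem HolderSpace.abs_le_norm (A : F.HolderSpace l α) (x : F.space) : |A x| ≤ ‖A‖ := by
  have h1 : 0 ≤ F.holderSeminorm l α A := holderSeminorm_nonneg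
  have h2 : |A x| ≤ F.supNorm A := IsHolder.abs_le A.2 x
  rw [HolderSpace.norm_def]
  linarith

theorem HolderSpace.norm_smul_le (c : ℝ) (A : F.HolderSpace l α) : ‖c • A‖ ≤ |c| * ‖A‖ := by
  have h1 : 0 ≤ F.holderSeminorm l α A := holderSeminorm_nonneg
  have h2 : 0 ≤ F.supNorm A := supNorm_nonneg
  rw [HolderSpace.norm_def, HolderSpace.norm_def, mul_add]
  refine add_le_add (Real.sSup_le ?_ (by positivity)) (Real.sSup_le ?_ (by positivity))
  · rintro _ ⟨x, y, h, h', rfl⟩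
    change |c * A x - c * A y| / _ ≤ _
    rw [← mul_sub, abs_mul, mul_div_assoc]
    exact mul_le_mul_of_nonneg_left (IsHolder.quot_le A.2 x y h h') (abs_nonneg c)
  · rintro _ ⟨x, rfl⟩
    change |c * A x| ≤ _
    rw [abs_mul]
    exact mul_le_mul_of_nonneg_left (IsHolder.abs_le A.2 x) (abs_nonneg c)

variable (F l α) in
/-- The constant functions as elements of the Hölder space. -/
def HolderSpace.const (c : ℝ) : F.HolderSpace l α :=
  ⟨fun _ => c, ⟨⟨|c|, by rintro _ ⟨x, rfl⟩; exact le_rfl⟩, ⟨0, by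
    rintro _ ⟨x, y, -, -, rfl⟩
    simp⟩⟩⟩

theorem HolderSpace.norm_const_le (c : ℝ) : ‖HolderSpace.const F l α c‖ ≤ |c| := by
  rw [HolderSpace.norm_def, ← zero_add |c|]
  refine add_le_add (Real.sSup_le ?_ le_rfl) (Real.sSup_le ?_ (abs_nonneg c))
  · rintro _ ⟨x, y, -, -, rfl⟩
    simp [HolderSpace.const]
  · rintro _ ⟨x, rfl⟩
    exact le_rfl

theorem HolderSpace.continuous (hl0 : 0 < l) (hl1 : l < 1) (hα0 : 0 < α) (A : F.HolderSpace l α) :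
    Continuous (A : F.space → ℝ) :=
  HasVariation.continuous (Real.rpow_nonneg hl0.le α) (Real.rpow_lt_one hl0.le hl1 hα0)
    (IsHolder.hasVariation A.2 hl0 hl1 hα0)

/-- Points on which the indicator differs have distance at least l ^ n, which bounds the quotients.
-/
theorem isHolder_indicator_cylinder (hl0 : 0 < l) (hl1 : l < 1) (hα0 : 0 < α) {n : ℕ}
    (w : Fin n → Fin q) : F.IsHolder l α ((F.cylinder w).indicator 1) := by
  classical
  have h01 : ∀ x, (F.cylinder w).indicator (1 : F.space → ℝ) x ∈ Set.Icc (0 : ℝ) 1 := fun x => by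
    by_cases hx : x ∈ F.cylinder w <;> simp [hx]
  refine ⟨⟨1, ?_⟩, ⟨1 / (l ^ n) ^ α, ?_⟩⟩
  · rintro _ ⟨x, rfl⟩
    exact abs_le.2 ⟨by linarith [(h01 x).1], (h01 x).2⟩
  · rintro _ ⟨x, y, h, -, rfl⟩
    have hn : 0 < (l ^ n) ^ α := by positivity
    by_cases hxy : ∀ i < n, x.1 i = y.1 i
    · have hiff : x ∈ F.cylinder w ↔ y ∈ F.cylinder w :=
        forall_congr' fun i => by rw [hxy i i.2]
      have e : (F.cylinder w).indicator (1 : F.space → ℝ) x = (F.cylinder w).indicator 1 y := by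
        simp [Set.indicator_apply, hiff]
      rw [e, sub_self, abs_zero, zero_div]
      positivity
    · push Not at hxy
      obtain ⟨i, hi, hxi⟩ := hxy
      have hne : x ≠ y := fun e => hxi (by rw [e])
      have hlt : PiNat.firstDiff x.1 y.1 < n := by
        by_contra! hle
        exact hxi (PiNat.apply_eq_of_lt_firstDiff (hi.trans_le hle))
      refine div_le_div₀ zero_le_one ?_ hn (Real.rpow_le_rpow (by positivity) ?_ hα0.le)
      · have h1 := h01 x
        have h2 := h01 y
        exact abs_le.2 ⟨by linarith [h1.1, h2.2], by linarith [h1.2, h2.1]⟩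
      · rw [seqDist_of_ne hne]
        exact pow_le_pow_of_le_one hl0.le hl1.le hlt.le

/-! ### Second differences of the maximal integral -/

variable (F) in
/-- The second difference of `maxIntegral` at `A` in the direction `t • e`. -/
noncomputable def secondDiff (A e : F.HolderSpace l α) (t : ℝ) : ℝ :=
  F.maxIntegral (A + t • e : F.HolderSpace l α) + F.maxIntegral (A - t • e : F.HolderSpace l α) -
    2 * F.maxIntegral A

theorem maxIntegral_le_add_norm (hne : F.space.Nonempty) (hmix : F.TopologicallyMixing)
    (hl0 : 0 < l) (hl1 : l < 1) (hα0 : 0 < α) (A B : F.HolderSpace l α) :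
    F.maxIntegral A ≤ F.maxIntegral B + ‖A - B‖ :=
  maxIntegral_le_add hne hmix (A.continuous hl0 hl1 hα0) (B.continuous hl0 hl1 hα0) fun x => by
    have h : A x - B x ≤ ‖A - B‖ := (le_abs_self _).trans ((A - B).abs_le_norm x)
    linarith

theorem continuous_maxIntegral (hne : F.space.Nonempty) (hmix : F.TopologicallyMixing)
    (hl0 : 0 < l) (hl1 : l < 1) (hα0 : 0 < α) :
    Continuous fun A : F.HolderSpace l α => F.maxIntegral A :=
  (LipschitzWith.of_le_add fun A B => by
    rw [dist_eq_norm]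
    exact maxIntegral_le_add_norm hne hmix hl0 hl1 hα0 A B).continuous

theorem maxIntegral_add_const (hne : F.space.Nonempty) (hmix : F.TopologicallyMixing)
    (hl0 : 0 < l) (hl1 : l < 1) (hα0 : 0 < α) (A : F.HolderSpace l α) (c : ℝ) :
    F.maxIntegral (A + HolderSpace.const F l α c : F.HolderSpace l α) = F.maxIntegral A + c := by
  have hA := A.continuous hl0 hl1 hα0
  have hAc := (A + HolderSpace.const F l α c).continuous hl0 hl1 hα0
  refine le_antisymm (maxIntegral_le_add hne hmix hAc hA fun x => le_rfl) ?_
  rw [← le_sub_iff_add_le, sub_eq_add_neg]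
  refine maxIntegral_le_add hne hmix hA hAc fun x => ?_
  change A x ≤ A x + c + -c
  linarith

/-- This makes the zero-pressure constraint harmless: correcting the pressure by a constant keeps a
small second difference. -/
theorem secondDiff_add_const (hne : F.space.Nonempty) (hmix : F.TopologicallyMixing)
    (hl0 : 0 < l) (hl1 : l < 1) (hα0 : 0 < α) (A e : F.HolderSpace l α) (c t : ℝ) :
    F.secondDiff (A + HolderSpace.const F l α c) e t = F.secondDiff A e t := by
  have h := maxIntegral_add_const hne hmix hl0 hl1 hα0 (c := c)
  rw [secondDiff, secondDiff, add_right_comm A, add_sub_right_comm A, h, h, h]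
  ring

/-- Arbitrarily close to `A` on the line `A + ℝ e` the second difference is small. -/
theorem exists_secondDiff_lt (hne : F.space.Nonempty) (hmix : F.TopologicallyMixing)
    (hl0 : 0 < l) (hl1 : l < 1) (hα0 : 0 < α) (A e : F.HolderSpace l α) {δ η : ℝ} (hδ : 0 < δ)
    (hη : 0 < η) :
    ∃ s t : ℝ, |s| ≤ δ ∧ 0 < t ∧ F.secondDiff (A + s • e) e t < t * η := by
  by_contra! hcon
  -- If every second difference were at least t η, the increments of f over steps of length t would
  -- grow by N t η > 2 t ‖e‖ in N steps, while each has absolute value at most t ‖e‖.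
  obtain ⟨N, hN⟩ := exists_nat_gt (2 * ‖e‖ / η)
  rw [div_lt_iff₀ hη] at hN
  -- With this step size the centres (j + 1) t, j ≤ N, stay within δ.
  set t : ℝ := δ / (N + 1) with ht
  have hN1 : (0 : ℝ) < N + 1 := by positivity
  have ht0 : 0 < t := div_pos hδ hN1
  set f : ℕ → ℝ := fun j => F.maxIntegral (A + (j * t) • e : F.HolderSpace l α) with hf
  have hstep : ∀ j ≤ N, t * η ≤ f (j + 1 + 1) - f (j + 1) - (f (j + 1) - f j) := by
    intro j hj
    have hs : |((j + 1 : ℕ) : ℝ) * t| ≤ δ := by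
      rw [abs_of_nonneg (by positivity)]
      calc ((j + 1 : ℕ) : ℝ) * t ≤ (N + 1) * t := by
            refine mul_le_mul_of_nonneg_right ?_ ht0.le
            exact_mod_cast Nat.succ_le_succ hj
        _ = δ := by
            rw [ht]
            field_simp
    have h := hcon _ t hs ht0
    have e1 : A + (((j + 1 : ℕ) : ℝ) * t) • e + t • e = A + (((j + 1 + 1 : ℕ) : ℝ) * t) • e := by
      rw [add_assoc, ← add_smul]
      push_cast
      ring_nf
    have e2 : A + (((j + 1 : ℕ) : ℝ) * t) • e - t • e = A + ((j : ℝ) * t) • e := by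
      rw [add_sub_assoc, ← sub_smul]
      push_cast
      ring_nf
    rw [secondDiff, e1, e2] at h
    simp only [hf]
    linarith
  have hsum : ∀ j ≤ N + 1, j * (t * η) ≤ f (j + 1) - f j - (f 1 - f 0) := by
    intro j
    induction j with
    | zero => simp
    | succ j ih =>
      intro hj
      have h1 := ih (by omega)
      have h2 := hstep j (by omega)
      push_cast
      linarith
  have hlip : ∀ j, |f (j + 1) - f j| ≤ t * ‖e‖ := by
    intro j
    have e1 : (A + (((j + 1 : ℕ) : ℝ) * t) • e) - (A + ((j : ℝ) * t) • e) = t • e := by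
      rw [add_sub_add_left_eq_sub, ← sub_smul]
      push_cast
      ring_nf
    have h1 := maxIntegral_le_add_norm hne hmix hl0 hl1 hα0
      (A + (((j + 1 : ℕ) : ℝ) * t) • e) (A + ((j : ℝ) * t) • e)
    have h2 := maxIntegral_le_add_norm hne hmix hl0 hl1 hα0
      (A + ((j : ℝ) * t) • e) (A + (((j + 1 : ℕ) : ℝ) * t) • e)
    rw [norm_sub_rev] at h2
    rw [e1] at h1 h2
    have h3 := HolderSpace.norm_smul_le t e
    rw [abs_of_pos ht0] at h3
    exact abs_le.2 ⟨by simp only [hf]; linarith, by simp only [hf]; linarith⟩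
  have h1 := hsum N (by omega)
  have h2 := (abs_le.1 (hlip N)).2
  have h3 := (abs_le.1 (hlip 0)).1
  rw [zero_add] at h3
  have h4 : t * (2 * ‖e‖) < t * (N * η) := mul_lt_mul_of_pos_left hN ht0
  linarith

/-- Use μ as a competitor for A + t e and ν for A - t e, then add. -/
theorem integral_sub_le_secondDiff (hne : F.space.Nonempty) (hmix : F.TopologicallyMixing)
    (hl0 : 0 < l) (hl1 : l < 1) (hα0 : 0 < α) {A : F.HolderSpace l α} (e : F.HolderSpace l α)
    (t : ℝ) {μ ν : Measure F.space} (hμ : μ ∈ F.maximizingMeasures A)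
    (hν : ν ∈ F.maximizingMeasures A) :
    t * (∫ x, e x ∂μ - ∫ x, e x ∂ν) ≤ F.secondDiff A e t := by
  have := hμ.1.1
  have := hν.1.1
  have hA := A.continuous hl0 hl1 hα0
  have he := e.continuous hl0 hl1 hα0
  have h1 := integral_le_maxIntegral hne hmix ((A + t • e).continuous hl0 hl1 hα0) hμ.1
  have h2 := integral_le_maxIntegral hne hmix ((A - t • e).continuous hl0 hl1 hα0) hν.1
  change ∫ x, (A x + t * e x) ∂μ ≤ _ at h1
  change ∫ x, (A x - t * e x) ∂ν ≤ _ at h2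
  rw [integral_add (integrable_of_continuous hA μ) ((integrable_of_continuous he μ).const_mul t),
    integral_const_mul, integral_eq_maxIntegral hμ] at h1
  rw [integral_sub (integrable_of_continuous hA ν) ((integrable_of_continuous he ν).const_mul t),
    integral_const_mul, integral_eq_maxIntegral hν] at h2
  rw [secondDiff]
  linarith

theorem abs_pressure_sub_le (hne : F.space.Nonempty) (A B : F.HolderSpace l α) :
    |F.pressure A - F.pressure B| ≤ ‖A - B‖ := by
  have h : ∀ A B : F.HolderSpace l α, F.pressure A ≤ F.pressure B + ‖A - B‖ := fun A B =>
    pressure_le_add hne A.abs_le_norm B.abs_le_norm fun x => by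
      have h : A x - B x ≤ ‖A - B‖ := (le_abs_self _).trans ((A - B).abs_le_norm x)
      linarith
  have h1 := h A B
  have h2 := h B A
  rw [norm_sub_rev] at h2
  exact abs_le.2 ⟨by linarith, by linarith⟩

theorem pressure_add_const (hne : F.space.Nonempty) (A : F.HolderSpace l α) (c : ℝ) :
    F.pressure (A + HolderSpace.const F l α c : F.HolderSpace l α) = F.pressure A + c := by
  refine le_antisymm (pressure_le_add hne (HolderSpace.abs_le_norm _) A.abs_le_norm
    fun x => le_rfl) ?_
  rw [← le_sub_iff_add_le, sub_eq_add_neg]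
  refine pressure_le_add hne A.abs_le_norm (HolderSpace.abs_le_norm _) fun x => ?_
  change A x ≤ A x + c + -c
  linarith

/-- The functions of zero pressure at which `maxIntegral` has a small second difference in the
direction `e` form a residual set. -/
theorem secondDiff_lt_mem_residual (hne : F.space.Nonempty) (hmix : F.TopologicallyMixing)
    (hl0 : 0 < l) (hl1 : l < 1) (hα0 : 0 < α) (e : F.HolderSpace l α) {η : ℝ} (hη : 0 < η) :
    {A : F.zeroPressure l α | ∃ t > 0, F.secondDiff A.1 e t < t * η} ∈
      residual (F.zeroPressure l α) := by
  have hM := continuous_maxIntegral (F := F) (α := α) hne hmix hl0 hl1 hα0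
  refine residual_of_dense_open ?_ (Metric.dense_iff.2 fun A ε hε => ?_)
  · have h : {A : F.zeroPressure l α | ∃ t > 0, F.secondDiff A.1 e t < t * η} =
        ⋃ t > 0, {A : F.zeroPressure l α | F.secondDiff A.1 e t < t * η} := by
      ext A
      simp
    rw [h]
    refine isOpen_biUnion fun t _ => isOpen_lt ?_ continuous_const
    exact ((hM.comp (continuous_subtype_val.add continuous_const)).add
      (hM.comp (continuous_subtype_val.sub continuous_const))).sub
        (continuous_const.mul (hM.comp continuous_subtype_val))
  · obtain ⟨s, t, hs, ht, hst⟩ := exists_secondDiff_lt hne hmix hl0 hl1 hα0 A.1 e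
      -- The factor 2 pays for the move along e and for the pressure correction, each of size at
      -- most |s| ‖e‖; the + 1 makes the estimate strict when s ≠ 0.
      (δ := ε / (2 * (‖e‖ + 1))) (by positivity) hη
    set B : F.HolderSpace l α := A.1 + s • e with hB
    have hBA : ‖B - A.1‖ ≤ |s| * ‖e‖ := by
      rw [hB, add_sub_cancel_left]
      exact HolderSpace.norm_smul_le s e
    have hPB : |F.pressure B| ≤ |s| * ‖e‖ := by
      have h := abs_pressure_sub_le hne B A.1
      rw [show F.pressure A.1 = 0 from A.2, sub_zero] at h
      exact h.trans hBA
    refine ⟨⟨B + HolderSpace.const F l α (-F.pressure B), ?_⟩, ?_, t, ht, ?_⟩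
    · change F.pressure _ = 0
      rw [pressure_add_const hne, add_neg_cancel]
    · rw [Metric.mem_ball, Subtype.dist_eq, dist_eq_norm, add_sub_right_comm]
      have h1 := norm_add_le (B - A.1) (HolderSpace.const F l α (-F.pressure B))
      have h2 := HolderSpace.norm_const_le (F := F) (l := l) (α := α) (-F.pressure B)
      rw [abs_neg] at h2
      have h3 : |s| * (2 * (‖e‖ + 1)) ≤ ε := by
        rwa [le_div_iff₀ (by positivity)] at hs
      rcases eq_or_ne s 0 with rfl | hs0
      · simp only [abs_zero, zero_mul] at hBA hPB
        linarith
      · have := abs_pos.2 hs0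
        linarith
    · change F.secondDiff (B + HolderSpace.const F l α (-F.pressure B)) e t < t * η
      rwa [secondDiff_add_const hne hmix hl0 hl1 hα0]

end SFT

/-! ### Generic uniqueness and unique ergodicity of the support -/

theorem theoremA {q : ℕ} (F : SFT q) (hne : F.space.Nonempty) (hmix : F.TopologicallyMixing)
    (l : ℝ) (hl0 : 0 < l) (hl1 : l < 1) (α : ℝ) (hα0 : 0 < α) (hα1 : α ≤ 1) :
    ∃ G ∈ residual (F.zeroPressure l α), ∀ A ∈ G,
      ∃ μ : Measure F.space,
        F.maximizingMeasures (A : F.HolderSpace l α) = {μ} ∧ F.UniquelyErgodicOn μ.support := by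
  let e : (Σ n : ℕ, Fin n → Fin q) → F.HolderSpace l α := fun w =>
    ⟨(F.cylinder w.2).indicator 1, SFT.isHolder_indicator_cylinder hl0 hl1 hα0 w.2⟩
  refine ⟨⋂ (w : Σ n : ℕ, Fin n → Fin q) (k : ℕ),
    {A : F.zeroPressure l α | ∃ t > 0, F.secondDiff A.1 (e w) t < t * (1 / ((k : ℝ) + 1))}, ?_, ?_⟩
  · exact countable_iInter_mem.2 fun w => countable_iInter_mem.2 fun k =>
      SFT.secondDiff_lt_mem_residual hne hmix hl0 hl1 hα0 (e w) (by positivity)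
  intro A hA
  -- One inequality suffices, since μ and ν can be exchanged.
  have hle : ∀ μ ∈ F.maximizingMeasures A.1, ∀ ν ∈ F.maximizingMeasures A.1,
      ∀ w, ∫ x, e w x ∂μ ≤ ∫ x, e w x ∂ν := by
    intro μ hμ ν hν w
    refine sub_nonpos.1 (le_of_forall_pos_lt_add fun η hη => ?_)
    obtain ⟨k, hk⟩ := exists_nat_one_div_lt hη
    obtain ⟨t, ht, hlt⟩ := Set.mem_iInter.1 (Set.mem_iInter.1 hA w) k
    have h := SFT.integral_sub_le_secondDiff hne hmix hl0 hl1 hα0 (e w) t hμ hν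
    have h' := lt_of_mul_lt_mul_left (h.trans_lt hlt) ht.le
    linarith
  have huniq : ∀ μ ∈ F.maximizingMeasures A.1, ∀ ν ∈ F.maximizingMeasures A.1, μ = ν := by
    intro μ hμ ν hν
    have := hμ.1.1
    have := hν.1.1
    refine SFT.ext_of_cylinder fun n w => ?_
    have h := le_antisymm (hle μ hμ ν hν ⟨n, w⟩) (hle ν hν μ hμ ⟨n, w⟩)
    have hms : MeasurableSet (F.cylinder w) := (SFT.isClopen_cylinder w).isOpen.measurableSet
    change ∫ x, (F.cylinder w).indicator 1 x ∂μ = ∫ x, (F.cylinder w).indicator 1 x ∂ν at h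
    rw [integral_indicator_one hms, integral_indicator_one hms] at h
    exact (measureReal_eq_measureReal_iff).1 h
  obtain ⟨μ, hμ⟩ := SFT.maximizingMeasures_nonempty hne hmix
    (SFT.HolderSpace.continuous hl0 hl1 hα0 A.1)
  refine ⟨μ, Set.eq_singleton_iff_unique_mem.2 ⟨hμ, fun ν hν => huniq ν hν μ hμ⟩,
    SFT.mapsTo_shift_support hμ.1, μ, ⟨hμ.1, Measure.measure_compl_support⟩, ?_⟩
  rintro ν ⟨hν, hνμ⟩
  -- By subordination ν is itself maximizing, so uniqueness of the maximizing measure identifies it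
  -- with μ.
  exact huniq ν (SFT.mem_maximizingMeasures_of_support hne hmix SFT.holderSeminorm_nonneg
    (Real.rpow_nonneg hl0.le α) (Real.rpow_lt_one hl0.le hl1 hα0)
    (SFT.IsHolder.hasVariation A.1.2 hl0 hl1 hα0) hμ hν hνμ) μ hμ
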